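/- For integers $n,k\ge 0$ let $s(n,k)$ denote the signed Stirling numbers of the first kind, defined by $z(z-1)\cdots(z-n+1)=\sum_{k=0}^n s(n,k)z^k$ and $s(n,k)=0$ for $k>n$. Let $\lambda<0$ be real and let $f$ be a complex function that is analytic in the half-plane $\operatorname{Re} z>\lambda$ and has moderate growth there, in the sense that for every $\mu>\lambda$ there are real constants $\sigma<\ln 2$ and $C$ with $|f(z)|\le C e^{\sigma|z|}$ whenever $\operatorname{Re} z\ge\mu$ (in particular, any $f$ of at most polynomial growth on each such half-plane is allowed). Then for every integer $m\ge 0$ $$\frac{f^{(m)}(0)}{m!}=\sum_{n=0}^{\infty}\frac{(-1)^n s(n,m)}{n!}\left\{\sum_{k=0}^n\binom{n}{k}(-1)^k f(k)\right\},$$ where the series over $n$ converges absolutely. The summation in fact starts from $n=m$, since $s(n,m)=0$ for $n<m$. -/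

import Mathlib

/-- The signed Stirling number of the first kind `s(n, k)`: the coefficient of `z ^ k` in the
falling factorial `z (z - 1) ⋯ (z - n + 1)`. -/
noncomputable def signedStirlingFirst (n k : ℕ) : ℤ :=
  (descPochhammer ℤ n).coeff k

/-- `f` has moderate growth in the open half-plane `Re z > lam`: on every smaller closed
half-plane `Re z ≥ μ`, `μ > lam`, it is of exponential type less than `log 2`, i.e.
`‖f z‖ ≤ C exp (σ ‖z‖)` with some `σ < log 2`. Bounds are only asked for away from the boundary
line, where `f` may be singular. Every function of polynomial growth qualifies. -/
def HasModerateGrowth (f : ℂ → ℂ) (lam : ℝ) : Prop :=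
  ∀ μ : ℝ, lam < μ → ∃ σ : ℝ, σ < Real.log 2 ∧ ∃ C : ℝ,
    ∀ z : ℂ, μ ≤ z.re → ‖f z‖ ≤ C * Real.exp (σ * ‖z‖)

/-! For small `z` the Newton series `f z = ∑ (z choose n) w n`, with `w n` equal to `(-1)^n` times
the binomial transform of `f`, converges to `f`. Expanding each falling factorial in powers of `z`
and exchanging sums gives a power series for `f` at `0`; uniqueness of Taylor coefficients yields
the formula.

The Newton series is controlled by Cauchy integrals over the circle of centre `N` and radius `N +
a`, with `0 < a ≤ 1` and `lam < -a`. It encloses `0, …, N` and stays in `Re ζ ≥ -a`. On it `|ζ - k|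
≥ k + a`, which makes `ζ(ζ-1)⋯(ζ-N)` at least of order `N! N^a`. Where `|ζ|` is large, the factors
with `k ≤ |ζ|/2` gain a further `2^|ζ|` up to a polynomial, and this absorbs the growth of `f`:
hence the threshold `log 2` (`le_norm_fallingProd`, `exists_norm_div_fallingProd_le`). So `w N =
O(N^(-a))`, and for `|z| ≤ a/2` the remainder is `O(N^(-a/2))`. Since `∑ |s(n,j)| δ^j` is bounded by
the rising factorial of `δ`, the double series converges absolutely at `δ = a/2`. In `ℂ`, `HasSum`
is unconditional, hence absolute, convergence. -/

/-! ### Binomial transforms and falling factorials. -/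

open Finset in
/-- The alternating binomial transform `∑ k ≤ n, (-1) ^ k * binom(n, k) * g k`. -/
noncomputable def binomialTransform (g : ℕ → ℂ) (n : ℕ) : ℂ :=
  ∑ k ∈ range (n + 1), (n.choose k : ℂ) * (-1 : ℂ) ^ k * g k

open Finset in
lemma binomialTransform_succ (g : ℕ → ℂ) (n : ℕ) :
    binomialTransform g (n + 1) =
      binomialTransform g n - binomialTransform (fun k => g (k + 1)) n := by
  unfold binomialTransform
  have h1 : ∑ k ∈ range (n + 1), (n.choose k : ℂ) * (-1 : ℂ) ^ k * g k =
      ∑ k ∈ range (n + 1), (n.choose (k + 1) : ℂ) * (-1 : ℂ) ^ (k + 1) * g (k + 1) + g 0 := by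
    rw [sum_range_succ' (fun k => (n.choose k : ℂ) * (-1 : ℂ) ^ k * g k), sum_range_succ]
    simp
  rw [sum_range_succ', h1, add_sub_right_comm, ← sum_sub_distrib]
  congr 1
  · refine sum_congr rfl fun k _ => ?_
    rw [Nat.choose_succ_succ]
    push_cast
    ring
  · simp

/-- The falling factorial `z (z - 1) ⋯ (z - n + 1)`. -/
noncomputable def fallingProd (n : ℕ) (z : ℂ) : ℂ := ∏ k ∈ Finset.range n, (z - k)

lemma fallingProd_zero (z : ℂ) : fallingProd 0 z = 1 := by simp [fallingProd]

lemma fallingProd_succ (n : ℕ) (z : ℂ) : fallingProd (n + 1) z = fallingProd n z * (z - n) := by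
  simp [fallingProd, Finset.prod_range_succ]

lemma fallingProd_succ' (n : ℕ) (z : ℂ) : fallingProd (n + 1) z = z * fallingProd n (z - 1) := by
  simp [fallingProd, Finset.prod_range_succ', sub_sub, add_comm, mul_comm]

lemma fallingProd_ne_zero {n : ℕ} {z : ℂ} (h : ∀ k < n, z ≠ k) : fallingProd n z ≠ 0 :=
  Finset.prod_ne_zero_iff.2 fun k hk => sub_ne_zero.2 (h k (Finset.mem_range.1 hk))

lemma continuous_fallingProd (n : ℕ) : Continuous (fallingProd n) := by
  unfold fallingProd
  fun_prop

/-- Iterate `1/(ζ-z) = 1/(ζ-M) + (z-M)/((ζ-M)(ζ-z))`. Integrated against `f`, this becomes Newton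
interpolation with remainder. -/
lemma inv_sub_eq_newton_sum {ζ z : ℂ} (hz : ζ ≠ z) (M : ℕ) (hζ : ∀ k < M, ζ ≠ k) :
    (ζ - z)⁻¹ = ∑ n ∈ Finset.range M, fallingProd n z * (fallingProd (n + 1) ζ)⁻¹ +
      fallingProd M z * ((fallingProd M ζ)⁻¹ * (ζ - z)⁻¹) := by
  induction M with
  | zero => simp [fallingProd_zero]
  | succ M ih =>
    refine (ih fun k hk => hζ k (hk.trans (Nat.lt_succ_self M))).trans ?_
    rw [Finset.sum_range_succ, add_assoc]
    congr 1
    have h1 : fallingProd M ζ ≠ 0 :=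
      fallingProd_ne_zero fun k hk => hζ k (hk.trans (Nat.lt_succ_self M))
    have h2 : ζ - M ≠ 0 := sub_ne_zero.2 (hζ M (Nat.lt_succ_self M))
    have h3 : ζ - z ≠ 0 := sub_ne_zero.2 hz
    rw [fallingProd_succ, fallingProd_succ]
    field_simp
    ring

/-- Partial fractions of `1/(ζ(ζ-1)⋯(ζ-n))`; in the induction, shifting the sequence amounts to
replacing `ζ` by `ζ - 1`. -/
lemma binomialTransform_inv_sub (n : ℕ) {ζ : ℂ} (hζ : ∀ k < n + 1, ζ ≠ k) :
    binomialTransform (fun k => (ζ - k)⁻¹) n =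
      (-1) ^ n * n.factorial * (fallingProd (n + 1) ζ)⁻¹ := by
  induction n generalizing ζ with
  | zero => simp [binomialTransform, fallingProd]
  | succ n ih =>
    have h' : ∀ k < n + 1, ζ - 1 ≠ k := by
      intro k hk h
      exact hζ (k + 1) (by omega) (by push_cast; linear_combination h)
    have h1 := ih fun k hk => hζ k (hk.trans (Nat.lt_succ_self _))
    have h2 := ih h'
    have e : (fun k : ℕ => (ζ - ((k + 1 : ℕ) : ℂ))⁻¹) = fun k : ℕ => (ζ - 1 - k)⁻¹ := by
      ext k
      push_cast
      ring_nf
    rw [binomialTransform_succ, e, h1, h2]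
    have n1 := fallingProd_ne_zero fun k hk => hζ k (hk.trans (Nat.lt_succ_self _))
    have n2 := fallingProd_ne_zero h'
    have n3 := fallingProd_ne_zero hζ
    have s1 := fallingProd_succ (n + 1) ζ
    have s2 := fallingProd_succ' (n + 1) ζ
    have i1 : (fallingProd (n + 1) ζ)⁻¹ = (ζ - (n + 1)) * (fallingProd (n + 1 + 1) ζ)⁻¹ := by
      rw [inv_eq_iff_eq_inv, mul_inv, inv_inv, s1]
      rw [s1] at n3
      have := right_ne_zero_of_mul n3
      push_cast at this ⊢
      field_simp
    have i2 : (fallingProd (n + 1) (ζ - 1))⁻¹ = ζ * (fallingProd (n + 1 + 1) ζ)⁻¹ := by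
      rw [inv_eq_iff_eq_inv, mul_inv, inv_inv, s2]
      rw [s2] at n3
      have := left_ne_zero_of_mul n3
      field_simp
    rw [i1, i2, Nat.factorial_succ]
    push_cast
    ring

/-! ### Newton interpolation with Cauchy integral remainder. -/

section Cauchy

variable {f : ℂ → ℂ} {c : ℂ} {R : ℝ}

lemma natCast_ne_of_mem_sphere {M : ℕ} (hk : ∀ k < M, (k : ℂ) ∈ Metric.ball c R) {ζ : ℂ}
    (hζ : ζ ∈ Metric.sphere c R) : ∀ k < M, ζ ≠ k := by
  rintro k hkM rfl
  exact (Metric.mem_ball.1 (hk k hkM)).ne (Metric.mem_sphere.1 hζ)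

lemma binomialTransform_eq_circleIntegral (hR : 0 ≤ R)
    (hf : DifferentiableOn ℂ f (Metric.closedBall c R)) (n : ℕ)
    (hk : ∀ k < n + 1, (k : ℂ) ∈ Metric.ball c R) :
    (2 * Real.pi * Complex.I) * binomialTransform (fun k => f k) n =
      (-1) ^ n * n.factorial * ∮ ζ in C(c, R), (fallingProd (n + 1) ζ)⁻¹ * f ζ := by
  have hfs : ContinuousOn f (Metric.sphere c R) := hf.continuousOn.mono Metric.sphere_subset_closedBall
  rw [← circleIntegral.integral_const_mul]
  trans ∮ ζ in C(c, R), ∑ k ∈ Finset.range (n + 1),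
    (n.choose k : ℂ) * (-1 : ℂ) ^ k * ((ζ - k)⁻¹ * f ζ)
  · rw [circleIntegral.integral_fun_sum, binomialTransform, Finset.mul_sum]
    · refine Finset.sum_congr rfl fun k hkn => ?_
      have := hf.circleIntegral_sub_inv_smul (hk k (Finset.mem_range.1 hkn))
      simp only [smul_eq_mul] at this
      rw [circleIntegral.integral_const_mul, this]
      ring
    · intro k hkn
      refine ContinuousOn.circleIntegrable hR ?_
      refine continuousOn_const.mul (ContinuousOn.mul (ContinuousOn.inv₀ (by fun_prop) ?_) hfs)
      exact fun ζ hζ => sub_ne_zero.2 (natCast_ne_of_mem_sphere hk hζ k (Finset.mem_range.1 hkn))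
  · refine circleIntegral.integral_congr hR fun ζ hζ => ?_
    have := binomialTransform_inv_sub n (natCast_ne_of_mem_sphere hk hζ)
    simp only [binomialTransform] at this
    rw [← mul_assoc, ← this, Finset.sum_mul]
    exact Finset.sum_congr rfl fun k _ => by ring

lemma eq_newton_sum_add_circleIntegral (hR : 0 ≤ R)
    (hf : DifferentiableOn ℂ f (Metric.closedBall c R)) (M : ℕ)
    (hk : ∀ k < M, (k : ℂ) ∈ Metric.ball c R) {z : ℂ} (hz : z ∈ Metric.ball c R) :
    f z = ∑ n ∈ Finset.range M, fallingProd n z / n.factorial *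
        ((-1) ^ n * binomialTransform (fun k => f k) n) +
      fallingProd M z * ((2 * Real.pi * Complex.I)⁻¹ *
        ∮ ζ in C(c, R), (fallingProd M ζ)⁻¹ * (ζ - z)⁻¹ * f ζ) := by
  have hfs : ContinuousOn f (Metric.sphere c R) := hf.continuousOn.mono Metric.sphere_subset_closedBall
  have hne : ∀ ζ ∈ Metric.sphere c R, ζ ≠ z := by
    rintro ζ hζ rfl
    exact (Metric.mem_ball.1 hz).ne (Metric.mem_sphere.1 hζ)
  have hcf : ∀ n ≤ M, ContinuousOn (fun ζ => (fallingProd n ζ)⁻¹) (Metric.sphere c R) :=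
    fun n hn => (continuous_fallingProd n).continuousOn.inv₀ fun ζ hζ =>
      fallingProd_ne_zero fun k hkn => natCast_ne_of_mem_sphere hk hζ k (hkn.trans_le hn)
  have hpi : (2 * Real.pi * Complex.I : ℂ) ≠ 0 := Complex.two_pi_I_ne_zero
  have hint : ∀ n ∈ Finset.range M, CircleIntegrable
      (fun ζ => fallingProd n z * ((fallingProd (n + 1) ζ)⁻¹ * f ζ)) c R := fun n hn =>
    ContinuousOn.circleIntegrable hR
      (continuousOn_const.mul ((hcf (n + 1) (Finset.mem_range.1 hn)).mul hfs))
  have key : (2 * Real.pi * Complex.I) * f z =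
      ∑ n ∈ Finset.range M, fallingProd n z *
        (∮ ζ in C(c, R), (fallingProd (n + 1) ζ)⁻¹ * f ζ) +
      fallingProd M z * ∮ ζ in C(c, R), (fallingProd M ζ)⁻¹ * (ζ - z)⁻¹ * f ζ := by
    simp_rw [← circleIntegral.integral_const_mul]
    rw [← circleIntegral.integral_fun_sum hint, ← circleIntegral.integral_add]
    · have := hf.circleIntegral_sub_inv_smul hz
      simp only [smul_eq_mul] at this
      rw [← this]
      refine circleIntegral.integral_congr hR fun ζ hζ => ?_
      refine (congrArg (· * f ζ)
        (inv_sub_eq_newton_sum (hne ζ hζ) M (natCast_ne_of_mem_sphere hk hζ))).trans ?_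
      simp only [add_mul, Finset.sum_mul, mul_assoc]
    · exact ContinuousOn.circleIntegrable hR (continuousOn_finsetSum _ fun n hn =>
        continuousOn_const.mul ((hcf (n + 1) (Finset.mem_range.1 hn)).mul hfs))
    · refine ContinuousOn.circleIntegrable hR (continuousOn_const.mul (((hcf M le_rfl).mul ?_).mul hfs))
      exact ContinuousOn.inv₀ (by fun_prop) fun ζ hζ => sub_ne_zero.2 (hne ζ hζ)
  rw [← mul_right_inj' hpi, key, mul_add, Finset.mul_sum]
  congr 1
  · refine Finset.sum_congr rfl fun n hn => ?_
    have := binomialTransform_eq_circleIntegral hR hf n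
      fun k hkn => hk k (hkn.trans_le (Finset.mem_range.1 hn))
    have hfac : (n.factorial : ℂ) ≠ 0 := by exact_mod_cast n.factorial_ne_zero
    have hs : ((-1 : ℂ) ^ n) * (-1) ^ n = 1 := by rw [← mul_pow]; simp
    calc _ = fallingProd n z / n.factorial * ((-1) ^ n * ((-1) ^ n * n.factorial *
          ∮ ζ in C(c, R), (fallingProd (n + 1) ζ)⁻¹ * f ζ)) := by
          rw [← mul_assoc ((-1 : ℂ) ^ n), ← mul_assoc ((-1 : ℂ) ^ n), hs]
          field_simp
      _ = _ := by rw [← this]; ring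
  · field_simp

end Cauchy

/-! ### Lower bounds for the falling factorial on the circle through `-a`. -/

lemma add_le_norm_sub_natCast {a : ℝ} {N k : ℕ} (hkN : k ≤ N) {ζ : ℂ}
    (hζ : ζ ∈ Metric.sphere (N : ℂ) (N + a)) : k + a ≤ ‖ζ - k‖ := by
  rw [mem_sphere_iff_norm] at hζ
  have h1 : ‖ζ - N‖ ≤ ‖ζ - k‖ + ‖((k : ℂ) - N)‖ := by
    simpa using norm_add_le (ζ - k) ((k : ℂ) - N)
  have h2 : ‖((k : ℂ) - N)‖ = N - k := by
    rw [norm_sub_rev, ← Nat.cast_sub hkN, Complex.norm_natCast, Nat.cast_sub hkN]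
  linarith

/-- Read backwards, the product is `m(m+1)⋯(2m-1)`, which for `m ≥ 1` is half of `m!` times the
central binomial coefficient. -/
lemma four_pow_mul_factorial_le (m : ℕ) :
    (4 : ℝ) ^ m * m.factorial ≤ 4 * (m + 1) * ∏ j ∈ Finset.range m, (2 * (m : ℝ) - (j + 1)) := by
  have hprod : ∏ j ∈ Finset.range m, (2 * (m : ℝ) - (j + 1)) = (m.ascFactorial m : ℕ) := by
    rw [Nat.ascFactorial_eq_prod_range, ← Finset.prod_range_reflect]
    push_cast
    refine Finset.prod_congr rfl fun j hj => ?_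
    have hj' : j + 1 ≤ m := Finset.mem_range.1 hj
    rw [Nat.sub_sub, add_comm 1 j, Nat.cast_sub hj']
    push_cast
    ring
  rw [hprod]
  rcases Nat.eq_zero_or_pos m with rfl | hm
  · norm_num
  · have h1 := Nat.four_pow_le_two_mul_self_mul_centralBinom m hm
    have h2 := Nat.succ_ascFactorial m m
    have h3 := Nat.ascFactorial_eq_factorial_mul_choose m m
    rw [Nat.succ_eq_add_one, h3, ← two_mul, ← Nat.centralBinom] at h2
    have h4 : 4 ^ m * m.factorial ≤ 4 * (m + 1) * m.ascFactorial m := by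
      calc 4 ^ m * m.factorial ≤ 2 * m * m.centralBinom * m.factorial := by gcongr
        _ = 2 * (m * (m.factorial * m.centralBinom)) := by ring
        _ = 4 * m * m.ascFactorial m := by rw [h2]; ring
        _ ≤ 4 * (m + 1) * m.ascFactorial m := by gcongr; omega
    exact_mod_cast h4

/-- An elementary Gamma-ratio estimate: Bernoulli's `(1 + 1/x)^a ≤ 1 + a/x`, valid for `a ≤ 1`,
drives each step. -/
lemma prod_mul_rpow_le {a : ℝ} (ha : 0 ≤ a) (ha1 : a ≤ 1) (m d : ℕ) :
    (∏ j ∈ Finset.range d, ((m : ℝ) + j + 1)) * ((m : ℝ) + d + 1) ^ a ≤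
      ((m : ℝ) + 1) ^ a * ∏ j ∈ Finset.range d, ((m : ℝ) + j + 1 + a) := by
  induction d with
  | zero => simp
  | succ d ih =>
    rw [Finset.prod_range_succ, Finset.prod_range_succ]
    set x : ℝ := (m : ℝ) + d + 1 with hx
    have hx0 : 0 < x := by positivity
    have h1 : (1 + x⁻¹) ^ a ≤ 1 + a * x⁻¹ :=
      rpow_one_add_le_one_add_mul_self (by have := inv_pos.2 hx0; linarith) ha ha1
    have h2 : x * (x + 1) ^ a ≤ x ^ a * (x + a) := by
      have e : x + 1 = x * (1 + x⁻¹) := by field_simp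
      rw [e, Real.mul_rpow hx0.le (by positivity)]
      calc x * (x ^ a * (1 + x⁻¹) ^ a) ≤ x * (x ^ a * (1 + a * x⁻¹)) := by gcongr
        _ = x ^ a * (x + a) := by field_simp
    have e2 : (m : ℝ) + ((d + 1 : ℕ) : ℝ) + 1 = x + 1 := by push_cast; ring
    rw [e2]
    calc _ = (∏ j ∈ Finset.range d, ((m : ℝ) + j + 1)) * (x * (x + 1) ^ a) := by ring
      _ ≤ (∏ j ∈ Finset.range d, ((m : ℝ) + j + 1)) * (x ^ a * (x + a)) := by gcongr
      _ = ((∏ j ∈ Finset.range d, ((m : ℝ) + j + 1)) * x ^ a) * (x + a) := by ring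
      _ ≤ (((m : ℝ) + 1) ^ a * ∏ j ∈ Finset.range d, ((m : ℝ) + j + 1 + a)) * (x + a) := by gcongr
      _ = _ := by ring

/-- The factor `k = 0` is at least `a`; those with `1 ≤ k ≤ m` are at least `2m - k` and produce
`4^m m!`; those with `k > m` are at least `k + a` and produce the rest of `N! (N+1)^a`. -/
lemma le_norm_fallingProd {a : ℝ} (ha : 0 < a) (ha1 : a ≤ 1) {N m : ℕ} (hm : m ≤ N) {ζ : ℂ}
    (hζ : ζ ∈ Metric.sphere (N : ℂ) (N + a)) (hmζ : 2 * (m : ℝ) ≤ ‖ζ‖) :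
    a * 4 ^ m * N.factorial * ((N : ℝ) + 1) ^ a ≤
      4 * ((m : ℝ) + 1) ^ 2 * ‖fallingProd (N + 1) ζ‖ := by
  obtain ⟨d, rfl⟩ := Nat.exists_eq_add_of_le hm
  have e1 : ‖fallingProd (m + d + 1) ζ‖ = (∏ j ∈ Finset.range m, ‖ζ - (j + 1 : ℕ)‖) *
      (∏ j ∈ Finset.range d, ‖ζ - (m + j + 1 : ℕ)‖) * ‖ζ‖ := by
    rw [fallingProd, norm_prod, Finset.prod_range_succ', Finset.prod_range_add]
    simp
  have h0 : a ≤ ‖ζ‖ := by simpa using add_le_norm_sub_natCast (Nat.zero_le _) hζ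
  have h1 : ∏ j ∈ Finset.range m, (2 * (m : ℝ) - (j + 1)) ≤
      ∏ j ∈ Finset.range m, ‖ζ - (j + 1 : ℕ)‖ := by
    refine Finset.prod_le_prod (fun j hj => ?_) fun j hj => ?_
    · have : (j : ℝ) + 1 ≤ m := by exact_mod_cast Finset.mem_range.1 hj
      linarith [(Nat.cast_nonneg m : (0 : ℝ) ≤ m)]
    · have := norm_sub_norm_le ζ (j + 1 : ℕ)
      rw [Complex.norm_natCast] at this
      push_cast at this ⊢
      linarith
  have h2 : ∏ j ∈ Finset.range d, ((m : ℝ) + j + 1 + a) ≤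
      ∏ j ∈ Finset.range d, ‖ζ - (m + j + 1 : ℕ)‖ := by
    refine Finset.prod_le_prod (fun j _ => by positivity) fun j hj => ?_
    have := add_le_norm_sub_natCast (k := m + j + 1) (by have := Finset.mem_range.1 hj; omega) hζ
    push_cast at this ⊢
    linarith
  have e2 : (((m + d).factorial : ℕ) : ℝ) =
      m.factorial * ∏ j ∈ Finset.range d, ((m : ℝ) + j + 1) := by
    rw [← Nat.factorial_mul_ascFactorial, Nat.ascFactorial_eq_prod_range]
    push_cast
    congr 1
    exact Finset.prod_congr rfl fun j _ => by ring
  have h3 := prod_mul_rpow_le ha.le ha1 m d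
  have h4 := four_pow_mul_factorial_le m
  have h5 : ((m : ℝ) + 1) ^ a ≤ m + 1 := by
    simpa using Real.rpow_le_rpow_of_exponent_le (x := (m : ℝ) + 1) (by simp) ha1
  have p1 : 0 ≤ ∏ j ∈ Finset.range m, ‖ζ - (j + 1 : ℕ)‖ := by positivity
  have p2 : 0 ≤ ∏ j ∈ Finset.range d, ((m : ℝ) + j + 1 + a) := by positivity
  rw [e1, e2]
  push_cast at h1 h2 h3 h4 h5 p1 p2 ⊢
  set A := ∏ j ∈ Finset.range m, ‖ζ - ((j : ℂ) + 1)‖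
  set B := ∏ j ∈ Finset.range d, ‖ζ - ((m : ℂ) + j + 1)‖
  calc _ = a * (4 ^ m * m.factorial) *
        ((∏ j ∈ Finset.range d, ((m : ℝ) + j + 1)) * ((m : ℝ) + d + 1) ^ a) := by ring
    _ ≤ a * (4 * (m + 1) * A) * (((m : ℝ) + 1) * B) := by
      gcongr ?_ * ?_ * ?_
      · exact h4.trans (by gcongr)
      · exact h3.trans (by gcongr)
    _ ≤ ‖ζ‖ * (4 * (m + 1) * A) * (((m : ℝ) + 1) * B) := by gcongr
    _ = _ := by ring

lemma exists_pow_four_mul_pow_le {ρ : ℝ} (h0 : 0 < ρ) (h1 : ρ < 1) :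
    ∃ B : ℝ, 0 ≤ B ∧ ∀ m : ℕ, ((m : ℝ) + 1) ^ 4 * ρ ^ m ≤ B := by
  have ht := (tendsto_pow_const_mul_const_pow_of_lt_one 4 h0.le h1).bddAbove_range
  obtain ⟨B, hB⟩ := ht
  have hB' : ∀ m : ℕ, (m : ℝ) ^ 4 * ρ ^ m ≤ B := fun m => hB ⟨m, rfl⟩
  refine ⟨B / ρ, div_nonneg (by simpa using hB' 0) h0.le, fun m => ?_⟩
  rw [le_div_iff₀ h0]
  have := hB' (m + 1)
  rw [pow_succ ρ] at this
  push_cast at this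
  linarith

lemma exists_norm_div_fallingProd_le {f : ℂ → ℂ} {a σ C : ℝ} (ha : 0 < a) (ha1 : a ≤ 1)
    (hσ0 : 0 ≤ σ) (hσ : σ < Real.log 2) (hC : 0 ≤ C)
    (hf : ∀ z : ℂ, -a ≤ z.re → ‖f z‖ ≤ C * Real.exp (σ * ‖z‖)) :
    ∃ K : ℝ, 0 ≤ K ∧ ∀ N : ℕ, ∀ ζ ∈ Metric.sphere (N : ℂ) (N + a),
      N.factorial * ((N : ℝ) + 1) ^ a * (‖fallingProd (N + 1) ζ‖⁻¹ * ‖f ζ‖) ≤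
        K * (1 + ‖ζ‖ ^ 2)⁻¹ := by
  -- The growth of `f` over two units of `|ζ|` against the gain `4` per unit of `m`; `ρ < 1` is
  -- exactly `σ < log 2`.
  set ρ : ℝ := Real.exp (2 * σ) / 4 with hρ
  have hρ0 : 0 < ρ := by positivity
  have hρ1 : ρ < 1 := by
    rw [hρ, div_lt_one (by norm_num)]
    calc Real.exp (2 * σ) < Real.exp (2 * Real.log 2) := by gcongr
      _ = 4 := by rw [two_mul, Real.exp_add, Real.exp_log two_pos]; norm_num
  obtain ⟨B, hB0, hB⟩ := exists_pow_four_mul_pow_le hρ0 hρ1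
  -- `20 = 4 · 5`: the `4` of `le_norm_fallingProd` and the `5` of `1 + r^2 ≤ 5 (m+1)^2`.
  refine ⟨20 / a * C * Real.exp (2 * σ) * B, by positivity, fun N ζ hζ => ?_⟩
  set r := ‖ζ‖ with hr
  have hr0 : 0 ≤ r := norm_nonneg _
  set m := ⌊r / 2⌋₊ with hm
  have hmr : 2 * (m : ℝ) ≤ r := by
    have := Nat.floor_le (div_nonneg hr0 zero_le_two)
    rw [← hm] at this
    linarith
  have hrm : r < 2 * ((m : ℝ) + 1) := by
    have := Nat.lt_floor_add_one (r / 2)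
    rw [← hm] at this
    linarith
  have hζ' : ‖ζ - N‖ = N + a := by rwa [mem_sphere_iff_norm] at hζ
  have hmN : m ≤ N := by
    have h1 : r ≤ ‖ζ - N‖ + ‖(N : ℂ)‖ := by simpa using norm_add_le (ζ - N) N
    rw [Complex.norm_natCast, hζ'] at h1
    have h2 : (m : ℝ) < (N + 1 : ℕ) := by push_cast; linarith
    exact Nat.lt_succ_iff.1 (by exact_mod_cast h2)
  have hre : -a ≤ ζ.re := by
    have := Complex.abs_re_le_norm (ζ - N)
    rw [hζ', Complex.sub_re, Complex.natCast_re] at this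
    linarith [(abs_le.1 this).1]
  have hlow := le_norm_fallingProd ha ha1 hmN hζ hmr
  have hq : 0 < ‖fallingProd (N + 1) ζ‖ := by
    by_contra! h
    have h' : 0 < a * 4 ^ m * N.factorial * ((N : ℝ) + 1) ^ a := by positivity
    have := le_antisymm h (norm_nonneg _)
    rw [this, mul_zero] at hlow
    linarith
  have h1 : N.factorial * ((N : ℝ) + 1) ^ a * ‖fallingProd (N + 1) ζ‖⁻¹ ≤
      4 / a * ((m : ℝ) + 1) ^ 2 / 4 ^ m := by
    rw [← div_eq_mul_inv, div_le_iff₀ hq]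
    have e : 4 / a * ((m : ℝ) + 1) ^ 2 / 4 ^ m * ‖fallingProd (N + 1) ζ‖ =
      (4 * ((m : ℝ) + 1) ^ 2 * ‖fallingProd (N + 1) ζ‖) / (a * 4 ^ m) := by field_simp
    rw [e, le_div_iff₀ (by positivity)]
    linarith
  have h2 : ‖f ζ‖ ≤ C * (Real.exp (2 * σ) * Real.exp (2 * σ) ^ m) := by
    refine (hf ζ hre).trans ?_
    gcongr
    rw [← Real.exp_nat_mul, ← Real.exp_add]
    gcongr
    nlinarith
  have h3 : 1 + r ^ 2 ≤ 5 * ((m : ℝ) + 1) ^ 2 := by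
    have : (0 : ℝ) ≤ m := Nat.cast_nonneg m
    nlinarith
  rw [← mul_assoc, ← div_eq_mul_inv (_ * B), le_div_iff₀ (by positivity)]
  calc _ ≤ (4 / a * ((m : ℝ) + 1) ^ 2 / 4 ^ m) *
        (C * (Real.exp (2 * σ) * Real.exp (2 * σ) ^ m)) * (5 * ((m : ℝ) + 1) ^ 2) := by gcongr
    _ = 20 / a * C * Real.exp (2 * σ) * (((m : ℝ) + 1) ^ 4 * ρ ^ m) := by
      rw [hρ, div_pow]; field_simp; ring
    _ ≤ _ := by gcongr; exact hB m

/-! ### Integrals over the circle, uniformly in `N`. -/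

/-- On the circle `|ζ|^2 = a^2 + 4N(N+a) cos²(θ/2)`, and Jordan's inequality bounds the cosine below
by a multiple of `|θ - π|`. -/
lemma sq_le_norm_circleMap_sq {a : ℝ} (ha : 0 ≤ a) (N : ℕ) {θ : ℝ}
    (hθ : θ ∈ Set.Ioc 0 (2 * Real.pi)) :
    ((N : ℝ) / 2 * θ - N / 2 * Real.pi) ^ 2 ≤ ‖circleMap (N : ℂ) (N + a) θ‖ ^ 2 := by
  have hN : (0 : ℝ) ≤ N := Nat.cast_nonneg N
  have hπ := Real.pi_pos
  set R : ℝ := N + a with hR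
  have h1 : ‖circleMap (N : ℂ) R θ‖ ^ 2 = (N + R * Real.cos θ) ^ 2 + (R * Real.sin θ) ^ 2 := by
    rw [← Complex.normSq_eq_norm_sq, Complex.normSq_apply]
    simp [circleMap, Complex.exp_ofReal_mul_I_re, Complex.exp_ofReal_mul_I_im]
    ring
  have h2 : Real.cos θ = 2 * Real.cos (θ / 2) ^ 2 - 1 := by
    rw [← Real.cos_two_mul]; ring_nf
  have h3 : |Real.pi / 2 - θ / 2| ≤ Real.pi / 2 := by
    rw [abs_le]
    constructor <;> linarith [hθ.1, hθ.2]
  have h4 := Real.mul_abs_le_abs_sin h3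
  rw [Real.sin_pi_div_two_sub] at h4
  have h5 : 1 / 2 * |Real.pi / 2 - θ / 2| ≤ |Real.cos (θ / 2)| := by
    have : 1 / 2 ≤ 2 / Real.pi := by
      rw [div_le_div_iff₀ two_pos hπ]
      linarith [Real.pi_le_four]
    exact (mul_le_mul_of_nonneg_right this (abs_nonneg _)).trans h4
  have h6 : (1 / 2 * (Real.pi / 2 - θ / 2)) ^ 2 ≤ Real.cos (θ / 2) ^ 2 := by
    rw [sq_le_sq, abs_mul, abs_of_pos (by norm_num : (0 : ℝ) < 1 / 2)]
    exact h5
  have h7 : ‖circleMap (N : ℂ) R θ‖ ^ 2 = (R - N) ^ 2 + 4 * N * R * Real.cos (θ / 2) ^ 2 := by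
    rw [h1, mul_pow, Real.sin_sq, h2]
    ring
  have h8 : (N : ℝ) * N ≤ N * R := by gcongr; linarith
  calc _ = 4 * ((N : ℝ) * N) * (1 / 2 * (Real.pi / 2 - θ / 2)) ^ 2 := by ring
    _ ≤ 4 * (N * R) * Real.cos (θ / 2) ^ 2 := by gcongr
    _ ≤ _ := by rw [h7]; nlinarith [sq_nonneg (R - N)]

/-- The integrand is concentrated in an angle of order `1/N` around `θ = π`, which cancels the
radius; the arctangent integral gives a bound free of `N`. -/
lemma norm_circleIntegral_le_of_norm_le_inv {g : ℂ → ℂ} {a A : ℝ} (ha : 0 ≤ a) (ha1 : a ≤ 1)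
    (hA : 0 ≤ A) {N : ℕ} (hN : 1 ≤ N)
    (hg : ∀ ζ ∈ Metric.sphere (N : ℂ) (N + a), ‖g ζ‖ ≤ A * (1 + ‖ζ‖ ^ 2)⁻¹) :
    ‖∮ ζ in C((N : ℂ), N + a), g ζ‖ ≤ 4 * Real.pi * A := by
  have hN' : (1 : ℝ) ≤ N := by exact_mod_cast hN
  have hR : (0 : ℝ) ≤ N + a := by positivity
  have hπ := Real.pi_pos
  have hbound : ∀ θ ∈ Set.Ioc 0 (2 * Real.pi),
      ‖deriv (circleMap (N : ℂ) (N + a)) θ • g (circleMap N (N + a) θ)‖ ≤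
        (N + a) * A * (1 + ((N : ℝ) / 2 * θ - N / 2 * Real.pi) ^ 2)⁻¹ := by
    intro θ hθ
    rw [norm_smul, deriv_circleMap, norm_mul, norm_circleMap_zero, Complex.norm_I, mul_one,
      abs_of_nonneg hR, mul_assoc]
    gcongr
    refine (hg _ (circleMap_mem_sphere _ hR θ)).trans ?_
    gcongr A * (1 + ?_)⁻¹
    exact sq_le_norm_circleMap_sq ha N hθ
  have hcont : Continuous fun θ : ℝ =>
      (N + a) * A * (1 + ((N : ℝ) / 2 * θ - N / 2 * Real.pi) ^ 2)⁻¹ := by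
    refine continuous_const.mul (Continuous.inv₀ (by fun_prop) fun θ => ?_)
    positivity
  refine (intervalIntegral.norm_integral_le_of_norm_le (by positivity)
    (Filter.Eventually.of_forall hbound) (hcont.intervalIntegrable _ _)).trans ?_
  rw [intervalIntegral.integral_const_mul,
    intervalIntegral.integral_comp_mul_sub (fun x : ℝ => (1 + x ^ 2)⁻¹)
      (by positivity : (N : ℝ) / 2 ≠ 0), integral_inv_one_add_sq, smul_eq_mul]
  set u := Real.arctan (N / 2 * (2 * Real.pi) - N / 2 * Real.pi) -
    Real.arctan ((N : ℝ) / 2 * 0 - N / 2 * Real.pi)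
  have hu : u ≤ Real.pi := by
    have h1 := Real.arctan_lt_pi_div_two (N / 2 * (2 * Real.pi) - N / 2 * Real.pi)
    have h2 := Real.neg_pi_div_two_lt_arctan ((N : ℝ) / 2 * 0 - N / 2 * Real.pi)
    simp only [u]
    linarith
  calc _ ≤ (N + a) * A * ((N / 2 : ℝ)⁻¹ * Real.pi) := by gcongr
    _ = (N + a) / N * (2 * Real.pi * A) := by field_simp
    _ ≤ 2 * (2 * Real.pi * A) := by
      gcongr
      rw [div_le_iff₀ (by linarith)]
      linarith
    _ = _ := by ring

/-! ### Stirling numbers and upper bounds for falling factorials. -/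

lemma signedStirlingFirst_eq_zero_of_lt {n k : ℕ} (h : n < k) : signedStirlingFirst n k = 0 :=
  Polynomial.coeff_eq_zero_of_natDegree_lt (by rwa [descPochhammer_natDegree])

lemma signedStirlingFirst_succ_zero (n : ℕ) :
    signedStirlingFirst (n + 1) 0 = -(n * signedStirlingFirst n 0) := by
  rw [signedStirlingFirst, descPochhammer_succ_right, mul_sub, Polynomial.coeff_sub,
    Polynomial.coeff_mul_natCast]
  simp [signedStirlingFirst, mul_comm]

lemma signedStirlingFirst_succ_succ (n k : ℕ) :
    signedStirlingFirst (n + 1) (k + 1) =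
      signedStirlingFirst n k - n * signedStirlingFirst n (k + 1) := by
  rw [signedStirlingFirst, descPochhammer_succ_right, mul_sub, Polynomial.coeff_sub,
    Polynomial.coeff_mul_natCast, Polynomial.coeff_mul_X]
  simp [signedStirlingFirst, mul_comm]

lemma fallingProd_eq_sum_signedStirlingFirst (n : ℕ) (z : ℂ) :
    fallingProd n z = ∑ j ∈ Finset.range (n + 1), (signedStirlingFirst n j : ℂ) * z ^ j := by
  rw [fallingProd, ← descPochhammer_eval_eq_prod_range,
    Polynomial.eval_eq_sum_range' (n := n + 1) (by rw [descPochhammer_natDegree]; omega)]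
  refine Finset.sum_congr rfl fun j _ => ?_
  rw [← descPochhammer_map (Int.castRingHom ℂ), Polynomial.coeff_map]
  rfl

lemma sum_abs_signedStirlingFirst_le {δ : ℝ} (hδ : 0 ≤ δ) (n : ℕ) :
    ∑ j ∈ Finset.range (n + 1), |(signedStirlingFirst n j : ℝ)| * δ ^ j ≤
      ∏ k ∈ Finset.range n, (δ + k) := by
  induction n with
  | zero => simp [signedStirlingFirst]
  | succ n ih =>
    rw [Finset.prod_range_succ, Finset.sum_range_succ']
    have h1 : ∑ j ∈ Finset.range (n + 1),
        |(signedStirlingFirst (n + 1) (j + 1) : ℝ)| * δ ^ (j + 1) ≤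
        δ * ∑ j ∈ Finset.range (n + 1), |(signedStirlingFirst n j : ℝ)| * δ ^ j +
        n * ∑ j ∈ Finset.range (n + 1), |(signedStirlingFirst n (j + 1) : ℝ)| * δ ^ (j + 1) := by
      rw [Finset.mul_sum, Finset.mul_sum, ← Finset.sum_add_distrib]
      refine Finset.sum_le_sum fun j _ => ?_
      rw [signedStirlingFirst_succ_succ]
      push_cast
      have := abs_sub (signedStirlingFirst n j : ℝ) (n * signedStirlingFirst n (j + 1))
      rw [abs_mul, Nat.abs_cast] at this
      calc _ ≤ (|(signedStirlingFirst n j : ℝ)| + n * |(signedStirlingFirst n (j + 1) : ℝ)|) *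
            δ ^ (j + 1) := by gcongr
        _ = _ := by ring
    have h2 : ∑ j ∈ Finset.range (n + 1), |(signedStirlingFirst n (j + 1) : ℝ)| * δ ^ (j + 1) +
        |(signedStirlingFirst n 0 : ℝ)| =
        ∑ j ∈ Finset.range (n + 1), |(signedStirlingFirst n j : ℝ)| * δ ^ j := by
      rw [Finset.sum_range_succ, signedStirlingFirst_eq_zero_of_lt (Nat.lt_succ_self n),
        Finset.sum_range_succ' _ n]
      simp
    have h3 : |(signedStirlingFirst (n + 1) 0 : ℝ)| = n * |(signedStirlingFirst n 0 : ℝ)| := by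
      rw [signedStirlingFirst_succ_zero]
      simp [abs_mul]
    rw [pow_zero, mul_one, h3]
    set S := ∑ j ∈ Finset.range (n + 1), |(signedStirlingFirst n j : ℝ)| * δ ^ j
    have h4 := congrArg ((n : ℝ) * ·) h2
    simp only [mul_add] at h4
    calc _ ≤ (δ + n) * S := by linarith
      _ ≤ (δ + n) * ∏ k ∈ Finset.range n, (δ + k) := by gcongr
      _ = _ := mul_comm _ _

/-- Bernoulli again, as `(1 - 1/x)^δ ≤ 1 - δ/x`, gives `(x-1)^δ (x+δ) ≤ x^(1+δ)`; the constant `2`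
covers `δ(δ+1)` at `N = 0`. -/
lemma prod_add_natCast_le {δ : ℝ} (h0 : 0 ≤ δ) (h1 : δ ≤ 1) (N : ℕ) :
    ∏ k ∈ Finset.range (N + 2), (δ + k) ≤ 2 * (N + 1).factorial * ((N : ℝ) + 1) ^ δ := by
  induction N with
  | zero =>
    simp [Finset.prod_range_succ]
    nlinarith
  | succ N ih =>
    rw [Finset.prod_range_succ]
    set x : ℝ := (N : ℝ) + 2 with hx
    have hx0 : 2 ≤ x := by rw [hx]; linarith [(Nat.cast_nonneg N : (0 : ℝ) ≤ N)]
    have hinv : x⁻¹ ≤ 1 := inv_le_one_of_one_le₀ (by linarith)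
    have h2 : (1 + -x⁻¹) ^ δ ≤ 1 + δ * -x⁻¹ :=
      rpow_one_add_le_one_add_mul_self (by linarith) h0 h1
    have h3 : ((N : ℝ) + 1) ^ δ * (δ + x) ≤ x * x ^ δ := by
      have e : (N : ℝ) + 1 = x * (1 + -x⁻¹) := by field_simp; rw [hx]; ring
      rw [e, Real.mul_rpow (by linarith) (by linarith)]
      calc x ^ δ * (1 + -x⁻¹) ^ δ * (δ + x) ≤ x ^ δ * (1 + δ * -x⁻¹) * (δ + x) := by gcongr
        _ = x ^ δ * (x - δ ^ 2 * x⁻¹) := by field_simp; ring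
        _ ≤ x ^ δ * x := by
          gcongr
          have : 0 ≤ δ ^ 2 * x⁻¹ := by positivity
          linarith
        _ = _ := mul_comm _ _
    have e2 : (((N + 1 + 1).factorial : ℕ) : ℝ) = x * (N + 1).factorial := by
      rw [Nat.factorial_succ (N + 1), hx]; push_cast; ring
    have e3 : ((N + 1 : ℕ) : ℝ) + 1 = x := by rw [hx]; push_cast; ring
    have e4 : ((N + 2 : ℕ) : ℝ) = x := by rw [hx]; push_cast; ring
    rw [show N + 1 + 1 = N + 2 from rfl] at *
    rw [e2, e3, e4]
    calc _ ≤ (2 * (N + 1).factorial * ((N : ℝ) + 1) ^ δ) * (δ + x) := by gcongr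
      _ = 2 * (N + 1).factorial * (((N : ℝ) + 1) ^ δ * (δ + x)) := by ring
      _ ≤ 2 * (N + 1).factorial * (x * x ^ δ) := by gcongr
      _ = _ := by ring

lemma norm_fallingProd_le {δ : ℝ} {z : ℂ} (hz : ‖z‖ ≤ δ) (n : ℕ) :
    ‖fallingProd n z‖ ≤ ∏ k ∈ Finset.range n, (δ + k) := by
  rw [fallingProd, norm_prod]
  refine Finset.prod_le_prod (fun _ _ => norm_nonneg _) fun k _ => ?_
  refine (norm_sub_le _ _).trans ?_
  rw [Complex.norm_natCast]
  gcongr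

/-! ### Convergence and rearrangement of the Newton series. -/

section NewtonSeries

variable {f : ℂ → ℂ} {a K : ℝ}

lemma natCast_mem_ball {N k : ℕ} (ha : 0 < a) (hk : k < N + 1) :
    (k : ℂ) ∈ Metric.ball (N : ℂ) (N + a) := by
  have hk' : k ≤ N := Nat.lt_succ_iff.1 hk
  rw [mem_ball_iff_norm, norm_sub_rev, ← Nat.cast_sub hk', Complex.norm_natCast, Nat.cast_sub hk']
  linarith [(Nat.cast_nonneg k : (0 : ℝ) ≤ k)]

lemma norm_binomialTransform_le (ha : 0 < a) (ha1 : a ≤ 1) (hK : 0 ≤ K) {N : ℕ} (hN : 1 ≤ N)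
    (hf : DifferentiableOn ℂ f (Metric.closedBall (N : ℂ) (N + a)))
    (hb : ∀ ζ ∈ Metric.sphere (N : ℂ) (N + a),
      N.factorial * ((N : ℝ) + 1) ^ a * (‖fallingProd (N + 1) ζ‖⁻¹ * ‖f ζ‖) ≤
        K * (1 + ‖ζ‖ ^ 2)⁻¹) :
    ‖binomialTransform (fun k => f k) N‖ ≤ 2 * K * (((N : ℝ) + 1) ^ a)⁻¹ := by
  have hπ := Real.pi_pos
  have hpos : 0 < N.factorial * ((N : ℝ) + 1) ^ a := by positivity
  have h := congrArg norm (binomialTransform_eq_circleIntegral (by positivity) hf N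
    fun k hk => natCast_mem_ball ha hk)
  have hI := norm_circleIntegral_le_of_norm_le_inv
    (g := fun ζ => (fallingProd (N + 1) ζ)⁻¹ * f ζ) (A := K / (N.factorial * ((N : ℝ) + 1) ^ a))
    ha.le ha1 (by positivity) hN (fun ζ hζ => by
      rw [norm_mul, norm_inv, div_mul_eq_mul_div, le_div_iff₀' hpos]
      exact hb ζ hζ)
  simp only [norm_mul, norm_pow, norm_neg, norm_one, one_pow, one_mul, Complex.norm_I, mul_one,
    Complex.norm_natCast, Complex.norm_real, Real.norm_eq_abs, abs_of_pos hπ,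
    Complex.norm_ofNat] at h
  have h2 : 2 * Real.pi * ‖binomialTransform (fun k => f k) N‖ ≤
      2 * Real.pi * (2 * K * (((N : ℝ) + 1) ^ a)⁻¹) := by
    rw [h]
    calc _ ≤ N.factorial * (4 * Real.pi * (K / (N.factorial * ((N : ℝ) + 1) ^ a))) := by gcongr
      _ = _ := by field_simp; ring
  exact le_of_mul_le_mul_left h2 (by positivity)

/-- Taking `|z| ≤ a/2` keeps `|ζ - z| ≥ a/2` on the circle, and the growth `N! N^(a/2)` of the
falling factorial at `z` uses only half of the exponent `a`. -/
lemma norm_sub_newton_sum_le (ha : 0 < a) (ha1 : a ≤ 1) (hK : 0 ≤ K) {N : ℕ} (hN : 1 ≤ N)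
    (hf : DifferentiableOn ℂ f (Metric.closedBall (N : ℂ) (N + a)))
    (hb : ∀ ζ ∈ Metric.sphere (N : ℂ) (N + a),
      N.factorial * ((N : ℝ) + 1) ^ a * (‖fallingProd (N + 1) ζ‖⁻¹ * ‖f ζ‖) ≤
        K * (1 + ‖ζ‖ ^ 2)⁻¹) {z : ℂ} (hz : ‖z‖ ≤ a / 2) :
    ‖f z - ∑ n ∈ Finset.range (N + 1), fallingProd n z / n.factorial *
        ((-1) ^ n * binomialTransform (fun k => f k) n)‖ ≤
      8 * K / a * (((N : ℝ) + 1) ^ (a / 2))⁻¹ := by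
  have hπ := Real.pi_pos
  have hpos : 0 < N.factorial * ((N : ℝ) + 1) ^ a := by positivity
  have hzb : z ∈ Metric.ball (N : ℂ) (N + a) := by
    rw [mem_ball_iff_norm]
    have := norm_sub_le z N
    rw [Complex.norm_natCast] at this
    linarith
  have h := eq_newton_sum_add_circleIntegral (by positivity) hf (N + 1)
    (fun k hk => natCast_mem_ball ha hk) hzb
  rw [← sub_eq_iff_eq_add'] at h
  rw [h]
  have hI := norm_circleIntegral_le_of_norm_le_inv
    (g := fun ζ => (fallingProd (N + 1) ζ)⁻¹ * (ζ - z)⁻¹ * f ζ)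
    (A := 2 / a * (K / (N.factorial * ((N : ℝ) + 1) ^ a))) ha.le ha1 (by positivity) hN
    (fun ζ hζ => by
      have h1 : a ≤ ‖ζ‖ := by simpa using add_le_norm_sub_natCast (Nat.zero_le _) hζ
      have h2 : a / 2 ≤ ‖ζ - z‖ := by linarith [norm_sub_norm_le ζ z]
      have h3 : ‖ζ - z‖⁻¹ ≤ 2 / a := by
        rw [← inv_div]
        gcongr
      have h4 : ‖fallingProd (N + 1) ζ‖⁻¹ * ‖f ζ‖ ≤
          K / (N.factorial * ((N : ℝ) + 1) ^ a) * (1 + ‖ζ‖ ^ 2)⁻¹ := by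
        rw [div_mul_eq_mul_div, le_div_iff₀' hpos]
        exact hb ζ hζ
      rw [norm_mul, norm_mul, norm_inv, norm_inv]
      calc _ = ‖ζ - z‖⁻¹ * (‖fallingProd (N + 1) ζ‖⁻¹ * ‖f ζ‖) := by ring
        _ ≤ 2 / a * (K / (N.factorial * ((N : ℝ) + 1) ^ a) * (1 + ‖ζ‖ ^ 2)⁻¹) := by gcongr
        _ = _ := by ring)
  have hp : ‖fallingProd (N + 1) z‖ ≤ 2 * N.factorial * ((N : ℝ) + 1) ^ (a / 2) := by
    obtain ⟨M, rfl⟩ := Nat.exists_eq_add_of_le' hN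
    refine (norm_fallingProd_le hz _).trans
      ((prod_add_natCast_le (by positivity) (by linarith) M).trans ?_)
    push_cast
    gcongr
    linarith
  have hsplit : ((N : ℝ) + 1) ^ a = ((N : ℝ) + 1) ^ (a / 2) * ((N : ℝ) + 1) ^ (a / 2) := by
    rw [← Real.rpow_add (by positivity), add_halves]
  simp only [norm_mul, norm_inv, Complex.norm_I, mul_one, Complex.norm_real, Real.norm_eq_abs,
    abs_of_pos hπ, Complex.norm_ofNat] at hI ⊢
  calc _ ≤ (2 * N.factorial * ((N : ℝ) + 1) ^ (a / 2)) * ((2 * Real.pi)⁻¹ *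
        (4 * Real.pi * (2 / a * (K / (N.factorial * ((N : ℝ) + 1) ^ a))))) := by gcongr
    _ = _ := by rw [hsplit]; field_simp; ring

lemma summable_prod_mul_of_norm_le {w : ℕ → ℂ} (ha : 0 < a) (ha1 : a ≤ 1) (hK : 0 ≤ K)
    (hw : ∀ N, 1 ≤ N → ‖w N‖ ≤ K * (((N : ℝ) + 1) ^ a)⁻¹) :
    Summable fun n => (∏ k ∈ Finset.range n, (a / 2 + k)) / n.factorial * ‖w n‖ := by
  rw [← summable_nat_add_iff 2]
  have hs : Summable fun n : ℕ => 2 * K * (1 / ((n + 2 : ℕ) : ℝ) ^ (1 + a / 2)) :=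
    ((summable_nat_add_iff 2).2
      (Real.summable_one_div_nat_rpow.2 (by linarith : 1 < 1 + a / 2))).mul_left _
  refine Summable.of_nonneg_of_le (fun n => by positivity) (fun n => ?_) hs
  set x : ℝ := ((n + 2 : ℕ) : ℝ) with hx
  have hx0 : 0 < x := by positivity
  have e : (((n + 2).factorial : ℕ) : ℝ) = x * (n + 1).factorial := by
    rw [Nat.factorial_succ (n + 1), hx]; push_cast; ring
  have h1 : (∏ k ∈ Finset.range (n + 2), (a / 2 + k)) / (n + 2).factorial ≤
      2 * x ^ (a / 2) / x := by
    rw [e, div_le_div_iff₀ (by positivity) hx0]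
    have := prod_add_natCast_le (δ := a / 2) (by positivity) (by linarith) n
    have h2 : ((n : ℝ) + 1) ^ (a / 2) ≤ x ^ (a / 2) := by
      gcongr
      rw [hx]
      push_cast
      linarith
    calc _ ≤ (2 * (n + 1).factorial * x ^ (a / 2)) * x := by
          gcongr
          exact this.trans (by gcongr)
      _ = _ := by ring
  have h3 : ‖w (n + 2)‖ ≤ K * (x ^ a)⁻¹ := by
    refine (hw (n + 2) (by omega)).trans ?_
    gcongr
    rw [hx]
    linarith
  have e2 : x ^ (1 + a / 2) * x ^ (a / 2) = x * x ^ a := by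
    rw [← Real.rpow_add hx0, ← Real.rpow_one_add' hx0.le (by positivity)]
    congr 1
    ring
  calc _ ≤ 2 * x ^ (a / 2) / x * (K * (x ^ a)⁻¹) := by gcongr
    _ = 2 * K * (x ^ (a / 2) / (x * x ^ a)) := by field_simp
    _ = _ := by rw [← e2]; field_simp

/-- Rearranging a Newton series by powers of the variable. -/
lemma hasSum_pow_of_hasSum_newton {w : ℕ → ℂ} {δ : ℝ} (hδ : 0 < δ)
    (hw : Summable fun n => (∏ k ∈ Finset.range n, (δ + k)) / n.factorial * ‖w n‖) :
    (∀ j, Summable fun n => (signedStirlingFirst n j : ℂ) / n.factorial * w n) ∧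
    ∀ z s : ℂ, ‖z‖ ≤ δ → HasSum (fun n => fallingProd n z / n.factorial * w n) s →
      HasSum (fun j => z ^ j * ∑' n, (signedStirlingFirst n j : ℂ) / n.factorial * w n) s := by
  have hF : ∀ z : ℂ, ‖z‖ ≤ δ → Summable fun p : ℕ × ℕ =>
      (signedStirlingFirst p.1 p.2 : ℂ) / p.1.factorial * w p.1 * z ^ p.2 := by
    intro z hz
    refine Summable.of_norm ((summable_prod_of_nonneg fun _ => norm_nonneg _).2 ⟨fun n => ?_, ?_⟩)
    · refine summable_of_ne_finset_zero (s := Finset.range (n + 1)) fun j hj => ?_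
      rw [signedStirlingFirst_eq_zero_of_lt (by simpa using hj)]
      simp
    · refine hw.of_nonneg_of_le (fun n => tsum_nonneg fun _ => norm_nonneg _) fun n => ?_
      rw [tsum_eq_sum (s := Finset.range (n + 1)) fun j hj => by
        rw [signedStirlingFirst_eq_zero_of_lt (by simpa using hj)]; simp]
      calc _ = (∑ j ∈ Finset.range (n + 1), |(signedStirlingFirst n j : ℝ)| * ‖z‖ ^ j) /
            n.factorial * ‖w n‖ := by
            rw [div_mul_eq_mul_div, Finset.sum_mul, Finset.sum_div]
            refine Finset.sum_congr rfl fun j _ => ?_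
            simp only [norm_mul, norm_div, norm_pow, Complex.norm_intCast, Complex.norm_natCast]
            ring
        _ ≤ (∑ j ∈ Finset.range (n + 1), |(signedStirlingFirst n j : ℝ)| * δ ^ j) /
            n.factorial * ‖w n‖ := by gcongr
        _ ≤ _ := by
          gcongr
          exact sum_abs_signedStirlingFirst_le hδ.le n
  have hcol : ∀ j, Summable fun n => (signedStirlingFirst n j : ℂ) / n.factorial * w n := by
    intro j
    -- A column of the double series at `z = δ`, divided by `δ^j`.
    have hδ' : (δ : ℂ) ^ j ≠ 0 := pow_ne_zero _ (Complex.ofReal_ne_zero.2 hδ.ne')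
    have h := (hF δ (by simp [abs_of_pos hδ])).prod_symm.prod_factor j
    simp only [Prod.swap] at h
    exact (summable_mul_right_iff hδ').1 h
  refine ⟨hcol, fun z s hz hs => ?_⟩
  have hrow : HasSum (fun n => fallingProd n z / n.factorial * w n)
      (∑' p : ℕ × ℕ, (signedStirlingFirst p.1 p.2 : ℂ) / p.1.factorial * w p.1 * z ^ p.2) := by
    refine (hF z hz).hasSum.prod_fiberwise fun n => ?_
    have h1 : HasSum (fun j => (signedStirlingFirst n j : ℂ) / n.factorial * w n * z ^ j)
        (∑ j ∈ Finset.range (n + 1),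
          (signedStirlingFirst n j : ℂ) / n.factorial * w n * z ^ j) := by
      refine hasSum_sum_of_ne_finset_zero fun j hj => ?_
      rw [signedStirlingFirst_eq_zero_of_lt (by simpa using hj)]
      simp
    have h2 : fallingProd n z / n.factorial * w n = ∑ j ∈ Finset.range (n + 1),
        (signedStirlingFirst n j : ℂ) / n.factorial * w n * z ^ j := by
      rw [fallingProd_eq_sum_signedStirlingFirst, div_mul_eq_mul_div, Finset.sum_mul,
        Finset.sum_div]
      exact Finset.sum_congr rfl fun j _ => by ring
    rw [h2]
    exact h1
  rw [hs.unique hrow]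
  have hswap := (Equiv.prodComm ℕ ℕ).hasSum_iff.2 (hF z hz).hasSum
  refine hswap.prod_fiberwise fun j => ?_
  rw [mul_comm]
  exact (hcol j).hasSum.mul_right (z ^ j)

end NewtonSeries

/-! ### Conclusion: comparison with the Taylor series. -/

lemma HasModerateGrowth.exists_bound {f : ℂ → ℂ} {lam μ : ℝ} (h : HasModerateGrowth f lam)
    (hμ : lam < μ) : ∃ σ C : ℝ, 0 ≤ σ ∧ σ < Real.log 2 ∧ 0 ≤ C ∧
      ∀ z : ℂ, μ ≤ z.re → ‖f z‖ ≤ C * Real.exp (σ * ‖z‖) := by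
  obtain ⟨σ, hσ, C, hC⟩ := h μ hμ
  refine ⟨max σ 0, |C|, le_max_right _ _, max_lt hσ (Real.log_pos one_lt_two), abs_nonneg _,
    fun z hz => (hC z hz).trans ?_⟩
  gcongr
  · exact le_abs_self C
  · exact le_max_left _ _

theorem proposition2 (f : ℂ → ℂ) (lam : ℝ) (hlam : lam < 0)
    (hf : AnalyticOnNhd ℂ f {z : ℂ | lam < z.re})
    (hgrowth : HasModerateGrowth f lam) (m : ℕ) :
    (∀ n : ℕ, n < m → signedStirlingFirst n m = 0) ∧
    HasSum
      (fun n : ℕ =>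
        ((-1 : ℂ) ^ n * (signedStirlingFirst n m : ℂ) / (n.factorial : ℂ)) *
          ∑ k ∈ Finset.range (n + 1), (n.choose k : ℂ) * (-1 : ℂ) ^ k * f (k : ℂ))
      (iteratedDeriv m f 0 / (m.factorial : ℂ)) := by
  refine ⟨fun n hn => signedStirlingFirst_eq_zero_of_lt hn, ?_⟩
  -- `lam < -a` keeps every closed disc inside the domain; `a ≤ 1` is for Bernoulli's inequality.
  obtain ⟨a, ha, ha1, hlama⟩ : ∃ a : ℝ, 0 < a ∧ a ≤ 1 ∧ lam < -a :=
    ⟨min (-lam / 2) 1, by simp; linarith, min_le_right _ _, by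
      linarith [min_le_left (-lam / 2) 1]⟩
  obtain ⟨σ, C, hσ0, hσ, hC, hbound⟩ := hgrowth.exists_bound hlama
  obtain ⟨K, hK, hb⟩ := exists_norm_div_fallingProd_le ha ha1 hσ0 hσ hC hbound
  have hd : ∀ N : ℕ, DifferentiableOn ℂ f (Metric.closedBall (N : ℂ) (N + a)) := by
    refine fun N => hf.differentiableOn.mono fun z hz => ?_
    rw [mem_closedBall_iff_norm] at hz
    have := (abs_le.1 ((Complex.abs_re_le_norm (z - N)).trans hz)).1
    rw [Complex.sub_re, Complex.natCast_re] at this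
    rw [Set.mem_ofPred_eq]
    linarith
  set w : ℕ → ℂ := fun n => (-1) ^ n * binomialTransform (fun k => f k) n with hw
  have hwle : ∀ N, 1 ≤ N → ‖w N‖ ≤ 2 * K * (((N : ℝ) + 1) ^ a)⁻¹ := by
    intro N hN
    simpa [hw] using norm_binomialTransform_le ha ha1 hK hN (hd N) (hb N)
  have hsum := summable_prod_mul_of_norm_le ha ha1 (by positivity) hwle
  obtain ⟨hcol, hpow⟩ := hasSum_pow_of_hasSum_newton (half_pos ha) hsum
  have hnewton : ∀ z : ℂ, ‖z‖ ≤ a / 2 →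
      HasSum (fun n => fallingProd n z / n.factorial * w n) (f z) := by
    intro z hz
    have hs : Summable fun n => ‖fallingProd n z / n.factorial * w n‖ := by
      refine hsum.of_nonneg_of_le (fun _ => norm_nonneg _) fun n => ?_
      rw [norm_mul, norm_div, Complex.norm_natCast]
      gcongr
      exact norm_fallingProd_le hz n
    -- Summability being known, the remainder bound along partial sums of length `N + 1` identifies
    -- the sum.
    rw [hasSum_iff_tendsto_nat_of_summable_norm hs, ← Filter.tendsto_add_atTop_iff_nat 1,
      tendsto_iff_norm_sub_tendsto_zero]
    have hlim : Filter.Tendsto (fun N : ℕ => 8 * K / a * (((N : ℝ) + 1) ^ (a / 2))⁻¹)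
        Filter.atTop (nhds 0) := by
      have h1 : Filter.Tendsto (fun N : ℕ => ((N : ℝ) + 1)) Filter.atTop Filter.atTop :=
        Filter.tendsto_atTop_add_const_right _ _ tendsto_natCast_atTop_atTop
      have := ((tendsto_rpow_atTop (half_pos ha)).comp h1).inv_tendsto_atTop.const_mul (8 * K / a)
      simpa using this
    refine squeeze_zero' (Filter.Eventually.of_forall fun _ => norm_nonneg _) ?_ hlim
    filter_upwards [Filter.eventually_ge_atTop 1] with N hN
    rw [norm_sub_rev]
    exact norm_sub_newton_sum_le ha ha1 hK hN (hd N) (hb N) hz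
  have hseries : HasFPowerSeriesAt f (FormalMultilinearSeries.ofScalars ℂ
      fun j => ∑' n, (signedStirlingFirst n j : ℂ) / n.factorial * w n) 0 := by
    rw [hasFPowerSeriesAt_iff]
    filter_upwards [Metric.closedBall_mem_nhds (0 : ℂ) (half_pos ha)] with z hz
    rw [mem_closedBall_zero_iff] at hz
    simpa [FormalMultilinearSeries.coeff_ofScalars] using hpow z (f z) hz (hnewton z hz)
  have htaylor := (hf 0 (by simpa using hlam)).hasFPowerSeriesAt
  have hcoeff := congrArg (fun p => FormalMultilinearSeries.coeff p m)
    (htaylor.eq_formalMultilinearSeries hseries)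
  simp only [FormalMultilinearSeries.coeff_ofScalars] at hcoeff
  rw [hcoeff]
  convert! (hcol m).hasSum using 1
  ext n
  simp only [hw, binomialTransform]
  ring
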